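/- Let $g:[0,1]\to[0,1]$ be a concave distortion function (non-decreasing, $g(0)=0$, $g(1)=1$), let $H_g(G)=-\int_{-\infty}^0\big(1-g(1-G(x))\big)\,dx+\int_0^\infty g(1-G(x))\,dx$ be the associated distortion risk measure on the set $\mathcal M^2$ of distribution functions on $\mathbb R$ with finite second moment, and let $\gamma(u)=\partial_-g(x)|_{x=1-u}$, $0<u<1$, be its weight function ($\partial_-$ is the left derivative). Assume that $H_g(G)=\int_0^1\gamma(u)G^{-1}(u)\,du$ for all $G\in\mathcal M^2$, where $G^{-1}(u)=\inf\{y: G(y)\ge u\}$, that $\int_0^1\gamma(u)^2\,du<\infty$, and that $\gamma\not\equiv1$ on $(0,1)$. Let $F\in\mathcal M^2$ have mean $\mu_F$ and standard deviation $\sigma_F>0$, let $0<\varepsilon<\infty$, and let $\mathcal M_\varepsilon=\{G\in\mathcal M^2: d_W(F,G)\le\sqrt\varepsilon\}$, where $d_W$ is the Wasserstein distance of order 2 (the infimum of $\mathbb E[(X_1-X_2)^2]^{1/2}$ over all couplings). Let $U$ be uniform on $(0,1)$, $V=\operatorname{var}(\gamma(U))$, $C_{\gamma,F}=\operatorname{cov}(F^{-1}(U),\gamma(U))$,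 $c_0=\operatorname{corr}(F^{-1}(U),\gamma(U))$, $$\mu^*=\mu_F+\sqrt{\frac{\varepsilon}{1+V}},\qquad \sigma^*=\sqrt{\sigma_F^2+\frac{2C_{\gamma,F}\sqrt\varepsilon}{\sqrt{1+V}}+\frac{\varepsilon V}{1+V}},$$ and for $\lambda\ge0$ $$h_\lambda(u)=\mu^*+\sigma^*\,\frac{\gamma(u)+\lambda F^{-1}(u)-a_\lambda}{b_\lambda},\qquad 0<u<1,$$ where $a_\lambda$ and $b_\lambda$ are the mean and the standard deviation of $\gamma(U)+\lambda F^{-1}(U)$; $d_W(F^{-1},h_\lambda)$ denotes the Wasserstein distance between $F$ and the distribution of $h_\lambda(U)$. Then the problem of maximising $H_g(G)$ over $G\in\mathcal M_\varepsilon$ has exactly one solution $G^*$. It has mean $\mu^*$ and standard deviation $\sigma^*$, and its quantile function is $h_\lambda$ (that is, $(G^*)^{-1}(u)=h_\lambda(u)$ for almost every $u\in(0,1)$, and for every $u$ at which $\gamma$ is continuous), where $\lambda\ge0$ solves $d_W(F^{-1},h_\lambda)=\sqrt\varepsilon$. If $c_0<1$, this equation has exactly one positive solution, namely $$\lambda=\frac{K}{\sigma_F^2}\sqrt{\frac{C_{\gamma,F}^2-V\sigma_F^2}{K^2-(\sigma^*)^2\sigma_F^2}}-\frac{C_{\gamma,F}}{\sigma_F^2},\qquad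 K=\frac{\mu_F^2+\sigma_F^2+(\mu^*)^2+(\sigma^*)^2-2\mu^*\mu_F-\varepsilon}{2};$$ if $c_0=1$, every $\lambda\ge0$ solves it. For every solution $\lambda\ge0$ of this equation the above holds, and the worst-case value is $$\max_{G\in\mathcal M_\varepsilon}H_g(G)=H_g(G^*)=\mu^*+\sigma^*\operatorname{std}(\gamma(U))\operatorname{corr}\big(\gamma(U),\,\gamma(U)+\lambda F^{-1}(U)\big).$$ -/

import Mathlib

open MeasureTheory ProbabilityTheory Set
open scoped ENNReal

noncomputable section

namespace DistortionRisk

/-- The law of a standard uniform random variable `U` on `(0,1)`. -/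
def unif : Measure ℝ := volume.restrict (Ioo (0 : ℝ) 1)

/-- Standard deviation. -/
def std (X : ℝ → ℝ) (P : Measure ℝ) : ℝ := √(Var[X; P])

/-- Correlation coefficient. -/
def corr (X Y : ℝ → ℝ) (P : Measure ℝ) : ℝ := cov[X, Y; P] / (std X P * std Y P)

/-- Distributions on the real line with finite second moment. A distribution is represented by
its law; the associated distribution function is `cdf G`. -/
def M2 : Set (Measure ℝ) := {G | IsProbabilityMeasure G ∧ MemLp id 2 G}

/-- The left-continuous inverse `G⁻¹(u) = inf {y | G(y) ≥ u}` (meaningful for `0 < u < 1`). -/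
def quantile (G : Measure ℝ) (u : ℝ) : ℝ := sInf {y : ℝ | u ≤ cdf G y}

/-- Mean of a distribution. -/
def mean (G : Measure ℝ) : ℝ := ∫ x, x ∂G

/-- Standard deviation of a distribution. -/
def sd (G : Measure ℝ) : ℝ := std id G

/-- The Wasserstein distance of order two: the infimum of `(E (X₁ - X₂)²)^(1/2)` over all
bivariate laws with marginals `G₁` and `G₂`. -/
def wasserstein (G₁ G₂ : Measure ℝ) : ℝ≥0∞ :=
  ⨅ π ∈ {π : Measure (ℝ × ℝ) | π.map Prod.fst = G₁ ∧ π.map Prod.snd = G₂},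
    (∫⁻ z, ENNReal.ofReal ((z.1 - z.2) ^ 2) ∂π) ^ (1 / 2 : ℝ)

/-- The law of `h(U)`: if `h` is non-decreasing on `(0,1)`, this is the distribution which has
quantile function `h`. -/
def lawOf (h : ℝ → ℝ) : Measure ℝ := unif.map h

/-- The distributions within Wasserstein distance `√ε` of the reference distribution `F`. -/
def wassersteinBall (F : Measure ℝ) (ε : ℝ) : Set (Measure ℝ) :=
  {G | G ∈ M2 ∧ wasserstein F G ≤ ENNReal.ofReal (√ε)}

/-- `g : [0,1] → [0,1]` is a distortion function: non-decreasing, `g 0 = 0`, `g 1 = 1`. Values of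
`g` outside `[0,1]` are irrelevant. -/
structure IsDistortion (g : ℝ → ℝ) : Prop where
  mono : MonotoneOn g (Icc 0 1)
  zero : g 0 = 0
  one : g 1 = 1

/-- The distortion risk measure as a Choquet integral,
`- ∫_{-∞}^0 (1 - g(1 - G(x))) dx + ∫_0^∞ g(1 - G(x)) dx`, with values in the extended reals
(meaningful if at least one of the two integrals is finite). -/
def riskMeasure (g : ℝ → ℝ) (G : Measure ℝ) : EReal :=
  ((∫⁻ x in Ioi (0 : ℝ), ENNReal.ofReal (g (1 - cdf G x)) : ℝ≥0∞) : EReal)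
    - ((∫⁻ x in Iio (0 : ℝ), ENNReal.ofReal (1 - g (1 - cdf G x)) : ℝ≥0∞) : EReal)

/-- The weight function `γ(u)`, the left derivative of `g` at `1 - u`, for `0 < u < 1`. -/
def weight (g : ℝ → ℝ) (u : ℝ) : ℝ := derivWithin g (Iic (1 - u)) (1 - u)

/-- The risk measure has the representation `H_g(G) = ∫_0^1 γ(u) G⁻¹(u) du` on all distributions
with finite second moment, and the weight function `γ` is square integrable. -/
structure HasWeightRepresentation (g : ℝ → ℝ) : Prop where
  repr : ∀ G ∈ M2, riskMeasure g G = ((∫ u, weight g u * quantile G u ∂unif : ℝ) : EReal)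
  memLp : MemLp (weight g) 2 unif

/-- `G` is a maximiser of `H_g` over the Wasserstein ball. -/
def IsWorstCase (g : ℝ → ℝ) (F : Measure ℝ) (ε : ℝ) (G : Measure ℝ) : Prop :=
  G ∈ wassersteinBall F ε ∧ ∀ G' ∈ wassersteinBall F ε, riskMeasure g G' ≤ riskMeasure g G

/-- `V = var(γ(U))`. -/
def varWeight (g : ℝ → ℝ) : ℝ := Var[weight g; unif]

/-- `C = cov(F⁻¹(U), γ(U))`. -/
def covWeight (g : ℝ → ℝ) (F : Measure ℝ) : ℝ := cov[quantile F, weight g; unif]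

/-- The function `γ + l F⁻¹`. -/
def tilted (g : ℝ → ℝ) (F : Measure ℝ) (l u : ℝ) : ℝ := weight g u + l * quantile F u

/-- The function `h_l(u) = μ + σ (γ(u) + l F⁻¹(u) - a_l) / b_l`, where `a_l` and `b_l` are the mean
and the standard deviation of `γ(U) + l F⁻¹(U)`. -/
def hFun (g : ℝ → ℝ) (F : Measure ℝ) (μ σ l u : ℝ) : ℝ :=
  μ + σ * ((tilted g F l u - ∫ v, tilted g F l v ∂unif) / std (tilted g F l) unif)

/-- `K = (μ_F² + σ_F² + μ² + σ² - 2 μ μ_F - ε) / 2`. -/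
def kConst (F : Measure ℝ) (ε μ σ : ℝ) : ℝ :=
  (mean F ^ 2 + sd F ^ 2 + μ ^ 2 + σ ^ 2 - 2 * μ * mean F - ε) / 2

/-- The explicit value
`λ = K / σ_F² * √((C² - V σ_F²) / (K² - σ² σ_F²)) - C / σ_F²`. -/
def lamFormula (g : ℝ → ℝ) (F : Measure ℝ) (ε μ σ : ℝ) : ℝ :=
  kConst F ε μ σ / sd F ^ 2 *
      √((covWeight g F ^ 2 - varWeight g * sd F ^ 2) /
        (kConst F ε μ σ ^ 2 - σ ^ 2 * sd F ^ 2))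
    - covWeight g F / sd F ^ 2

/-- `μ* = μ_F + √(ε / (1 + V))`. -/
def muStar (g : ℝ → ℝ) (F : Measure ℝ) (ε : ℝ) : ℝ := mean F + √(ε / (1 + varWeight g))

/-- `σ* = √(σ_F² + 2 C √ε / √(1 + V) + ε V / (1 + V))`. -/
def sigmaStar (g : ℝ → ℝ) (F : Measure ℝ) (ε : ℝ) : ℝ :=
  √(sd F ^ 2 + 2 * covWeight g F * √ε / √(1 + varWeight g)
    + ε * varWeight g / (1 + varWeight g))

/-- The function `h_l` with the optimal moments `μ*` and `σ*`. -/
def hStar (g : ℝ → ℝ) (F : Measure ℝ) (ε l : ℝ) : ℝ → ℝ :=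
  hFun g F (muStar g F ε) (sigmaStar g F ε) l

end DistortionRisk

end

open DistortionRisk

namespace DistortionRisk

open Filter Topology

/-! Passing to quantile functions turns the problem into one about a ball in `L²(0,1)`. The
comonotone coupling is optimal on the line (`wasserstein_eq`), so the constraint reads `‖F⁻¹ - Z‖² ≤
ε`, while the objective is the linear functional `⟨γ, Z⟩`. By Cauchy–Schwarz its only maximiser on
the ball is `F⁻¹ + c γ` with `c ‖γ‖ = √ε`. Testing the representation on a point mass gives `∫ γ =
1`, so `‖γ‖² = 1 + V` and `c = √(ε / (1 + V))`. Concavity of `g` makes `γ` non-decreasing, so this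
maximiser is a.e. a quantile function and solves the original problem
(`two_mul_integral_weight_gap`, `isWorstCase_lawOf_shifted`); its moments are `μ*` and `σ*`.

The function `h_λ` rescales `γ + λ F⁻¹` to these moments. Its distance to `F⁻¹` is `√ε` exactly when
`c λ = 1` or the Gram determinant `V σ_F² - C²` vanishes (`wasserstein_hStar_eq_iff`). In both cases
`h_λ = F⁻¹ + c γ` a.e. (`hStar_ae_eq_shifted`), and the formula for `λ` is a disguised `1 / c` when
the determinant is nonzero. -/

lemma unif_eq_restrict_Ioc : unif = volume.restrict (Ioc (0 : ℝ) 1) :=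
  Measure.restrict_congr_set Ioo_ae_eq_Ioc

instance isProbabilityMeasure_unif : IsProbabilityMeasure unif :=
  ⟨by simp [unif]⟩

instance nullSingletonClass_unif : NullSingletonClass unif := by
  unfold unif
  infer_instance

lemma ae_unif_mem : ∀ᵐ u ∂unif, u ∈ Ioo (0 : ℝ) 1 :=
  ae_restrict_mem measurableSet_Ioo

lemma unif_Ioc {s t : ℝ} (ht : 0 ≤ t) (hs : s ≤ 1) : unif (Ioc t s) = ENNReal.ofReal (s - t) := by
  rw [unif_eq_restrict_Ioc, Measure.restrict_apply measurableSet_Ioc,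
    inter_eq_left.2 (Ioc_subset_Ioc ht hs), Real.volume_Ioc]

lemma unif_Iic {c : ℝ} (hc : c ≤ 1) : unif (Iic c) = ENNReal.ofReal c := by
  rw [unif_eq_restrict_Ioc, Measure.restrict_apply measurableSet_Iic, inter_comm, Ioc_inter_Iic,
    min_eq_right hc, Real.volume_Ioc, sub_zero]

lemma aemeasurable_of_monotoneOn {h : ℝ → ℝ} (hh : MonotoneOn h (Ioo 0 1)) : AEMeasurable h unif :=
  aemeasurable_restrict_of_monotoneOn measurableSet_Ioo hh

/-! ### Quantile functions and the inverse transform -/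

section Quantile

variable (G : Measure ℝ)

lemma bddBelow_setOf_le_cdf {u : ℝ} (hu : 0 < u) : BddBelow {y : ℝ | u ≤ cdf G y} := by
  obtain ⟨a, ha⟩ := ((tendsto_cdf_atBot G).eventually (gt_mem_nhds hu)).exists
  refine ⟨a, fun y hy => le_of_not_gt fun hlt => ?_⟩
  exact absurd (hy.trans (monotone_cdf G hlt.le)) (not_le.2 ha)

lemma nonempty_setOf_le_cdf {u : ℝ} (hu : u < 1) : {y : ℝ | u ≤ cdf G y}.Nonempty := by
  obtain ⟨a, ha⟩ := ((tendsto_cdf_atTop G).eventually (lt_mem_nhds hu)).exists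
  exact ⟨a, ha.le⟩

/-- Right continuity of the cdf means that the infimum is attained. This Galois connection is what
later arguments use in place of the infimum. -/
lemma quantile_le_iff {u : ℝ} (hu : u ∈ Ioo (0 : ℝ) 1) (x : ℝ) :
    quantile G u ≤ x ↔ u ≤ cdf G x := by
  refine ⟨fun h => ?_, fun h => csInf_le (bddBelow_setOf_le_cdf G hu.1) h⟩
  have hr : Tendsto (cdf G) (𝓝[>] x) (𝓝 (cdf G x)) :=
    ((cdf G).right_continuous x).mono_left (nhdsWithin_mono _ Ioi_subset_Ici_self)
  refine ge_of_tendsto hr ?_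
  filter_upwards [self_mem_nhdsWithin] with y hy
  obtain ⟨s, hs, hsy⟩ := exists_lt_of_csInf_lt (nonempty_setOf_le_cdf G hu.2) (h.trans_lt hy)
  exact le_trans hs (monotone_cdf G hsy.le)

lemma lt_quantile_iff {u : ℝ} (hu : u ∈ Ioo (0 : ℝ) 1) (x : ℝ) :
    x < quantile G u ↔ cdf G x < u := by
  rw [← not_le, quantile_le_iff G hu, not_le]

lemma monotoneOn_quantile : MonotoneOn (quantile G) (Ioo 0 1) := fun _ hu _ hv huv =>
  (quantile_le_iff G hu _).2 (huv.trans ((quantile_le_iff G hv _).1 le_rfl))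

lemma aemeasurable_quantile : AEMeasurable (quantile G) unif :=
  aemeasurable_of_monotoneOn (monotoneOn_quantile G)

lemma map_quantile [IsProbabilityMeasure G] : unif.map (quantile G) = G := by
  have := Measure.isProbabilityMeasure_map (aemeasurable_quantile G)
  refine Measure.ext_of_Iic _ _ fun x => ?_
  rw [Measure.map_apply_of_aemeasurable (aemeasurable_quantile G) measurableSet_Iic,
    ← ofReal_cdf, ← unif_Iic (cdf_le_one G x)]
  refine measure_congr ?_
  filter_upwards [ae_unif_mem] with u hu
  exact propext (quantile_le_iff G hu x)

/-- Quantile functions are left-continuous. -/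
lemma continuousWithinAt_quantile {u : ℝ} (hu : u ∈ Ioo (0 : ℝ) 1) :
    ContinuousWithinAt (quantile G) (Iio u) u := by
  rw [ContinuousWithinAt, tendsto_order]
  have hmem : ∀ᶠ v in 𝓝[<] u, v ∈ Ioo 0 u := Ioo_mem_nhdsLT hu.1
  constructor
  · intro a ha
    filter_upwards [Ioo_mem_nhdsLT ((lt_quantile_iff G hu a).1 ha), hmem] with v hv hv'
    exact (lt_quantile_iff G ⟨hv'.1, hv'.2.trans hu.2⟩ a).2 hv.1
  · intro a ha
    filter_upwards [hmem] with v hv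
    exact (monotoneOn_quantile G ⟨hv.1, hv.2.trans hu.2⟩ hu hv.2.le).trans_lt ha

end Quantile

/-- A monotone function is the quantile function of its law where it is left-continuous. -/
lemma quantile_lawOf {h : ℝ → ℝ} (hh : MonotoneOn h (Ioo 0 1)) {u : ℝ} (hu : u ∈ Ioo (0 : ℝ) 1)
    (hc : ContinuousWithinAt h (Iio u) u) : quantile (lawOf h) u = h u := by
  have hm := aemeasurable_of_monotoneOn hh
  have : IsProbabilityMeasure (lawOf h) := Measure.isProbabilityMeasure_map hm
  -- Comparing levels through `unif` reduces both inequalities to a.e. inclusions of sublevel sets.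
  have hle : ∀ {v x : ℝ}, 0 ≤ v → v ≤ 1 → 
      (v ≤ cdf (lawOf h) x ↔ unif (Iic v) ≤ unif (h ⁻¹' Iic x)) := by
    intro v x hv0 hv
    rw [unif_Iic hv, ← Measure.map_apply_of_aemeasurable hm measurableSet_Iic]
    change _ ↔ _ ≤ lawOf h (Iic x)
    rw [← ofReal_cdf, ENNReal.ofReal_le_ofReal_iff (cdf_nonneg _ _)]
  apply le_antisymm
  · rw [quantile_le_iff _ hu, hle hu.1.le hu.2.le]
    refine measure_mono_ae ?_
    filter_upwards [ae_unif_mem] with v hv hvu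
    exact hh hv hu hvu
  · refine le_of_forall_lt fun y hy => ?_
    rw [lt_quantile_iff _ hu]
    have h1 : ∀ᶠ v in 𝓝[<] u, y < h v := hc.eventually (lt_mem_nhds hy)
    -- Left continuity gives `v < u` with `y < h v`; then `{h ≤ y}` lies a.e. below `v`, so the cdf
    -- at `y` is at most `v`.
    obtain ⟨v, hv, hv0⟩ := (h1.and (Ioo_mem_nhdsLT hu.1)).exists
    refine lt_of_le_of_lt ?_ hv0.2
    rw [← ENNReal.ofReal_le_ofReal_iff hv0.1.le, ofReal_cdf,
      ← unif_Iic (hv0.2.le.trans hu.2.le), lawOf,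
      Measure.map_apply_of_aemeasurable hm measurableSet_Iic]
    refine measure_mono_ae ?_
    filter_upwards [ae_unif_mem] with w hw hwy
    refine le_of_not_gt fun hlt => ?_
    exact absurd (hv.trans_le (hh ⟨hv0.1, hv0.2.trans hu.2⟩ hw hlt.le)) (not_lt.2 hwy)

lemma ae_continuousAt_of_monotoneOn {h : ℝ → ℝ} (hh : MonotoneOn h (Ioo 0 1)) :
    ∀ᵐ u ∂unif, ContinuousAt h u := by
  have hnull := hh.countable_not_continuousWithinAt.measure_zero unif
  filter_upwards [ae_unif_mem, measure_eq_zero_iff_ae_notMem.1 hnull] with u hu hu'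
  have : ContinuousWithinAt h (Ioo 0 1) u := by
    by_contra hcon
    exact hu' ⟨hu, hcon⟩
  exact this.continuousAt (Ioo_mem_nhds hu.1 hu.2)

lemma ae_quantile_lawOf {h : ℝ → ℝ} (hh : MonotoneOn h (Ioo 0 1)) :
    ∀ᵐ u ∂unif, quantile (lawOf h) u = h u := by
  filter_upwards [ae_unif_mem, ae_continuousAt_of_monotoneOn hh] with u hu hc
  exact quantile_lawOf hh hu hc.continuousWithinAt

/-! ### Optimality of the comonotone coupling -/

section Coupling

/-- The squared distance is the area of a square, and at least one of the two squares is empty.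
Tonelli then turns the quadratic cost into an integral of probabilities of the form `π {X ≤ s, t <
Y}`. -/
lemma ofReal_sq_sub_eq_volume (x y : ℝ) : ENNReal.ofReal ((x - y) ^ 2) =
    volume (Ico x y ×ˢ Ico x y) + volume (Ico y x ×ˢ Ico y x) := by
  simp only [Measure.volume_eq_prod, Measure.prod_prod, Real.volume_Ico]
  rcases le_total x y with h | h
  · rw [ENNReal.ofReal_of_nonpos (sub_nonpos.2 h), ← ENNReal.ofReal_mul (sub_nonneg.2 h)]
    simp only [mul_zero, add_zero]
    congr 1; ring
  · rw [ENNReal.ofReal_of_nonpos (sub_nonpos.2 h), ← ENNReal.ofReal_mul (sub_nonneg.2 h)]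
    simp only [mul_zero, zero_add]
    congr 1; ring

lemma mem_Ico_prod_Ico_iff (x y : ℝ) (p : ℝ × ℝ) :
    p ∈ Ico x y ×ˢ Ico x y ↔ x ≤ min p.1 p.2 ∧ max p.1 p.2 < y := by
  simp only [mem_prod, mem_Ico, le_min_iff, max_lt_iff]
  tauto

lemma measurableSet_le_and_lt {α : Type*} [MeasurableSpace α] {a b c d : α → ℝ}
    (ha : Measurable a) (hb : Measurable b) (hc : Measurable c) (hd : Measurable d) :
    MeasurableSet {z | a z ≤ b z ∧ c z < d z} :=
  (measurableSet_le ha hb).inter (measurableSet_lt hc hd)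

lemma lintegral_volume_Ico_prod {π : Measure (ℝ × ℝ)} [SFinite π] {a b : ℝ × ℝ → ℝ}
    (ha : Measurable a) (hb : Measurable b) :
    ∫⁻ z, volume (Ico (a z) (b z) ×ˢ Ico (a z) (b z)) ∂π =
      ∫⁻ p : ℝ × ℝ, π {z | a z ≤ min p.1 p.2 ∧ max p.1 p.2 < b z} := by
  have hs : MeasurableSet {q : (ℝ × ℝ) × (ℝ × ℝ) |
      a q.1 ≤ min q.2.1 q.2.2 ∧ max q.2.1 q.2.2 < b q.1} :=
    measurableSet_le_and_lt (by fun_prop) (by fun_prop) (by fun_prop) (by fun_prop)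
  have h1 := Measure.prod_apply (μ := π) (ν := (volume : Measure (ℝ × ℝ))) hs
  rw [Measure.prod_apply_symm hs] at h1
  refine Eq.trans ?_ h1.symm
  refine lintegral_congr fun z => ?_
  congr 1
  ext p
  exact mem_Ico_prod_Ico_iff _ _ p

lemma lintegral_sq_sub_eq (π : Measure (ℝ × ℝ)) [SFinite π] :
    ∫⁻ z, ENNReal.ofReal ((z.1 - z.2) ^ 2) ∂π =
      (∫⁻ p : ℝ × ℝ, π {z | z.1 ≤ min p.1 p.2 ∧ max p.1 p.2 < z.2}) +
        ∫⁻ p : ℝ × ℝ, π {z | z.2 ≤ min p.1 p.2 ∧ max p.1 p.2 < z.1} := by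
  have hmeas : Measurable fun z : ℝ × ℝ => volume (Ico z.1 z.2 ×ˢ Ico z.1 z.2) := by
    simp only [Measure.volume_eq_prod, Measure.prod_prod, Real.volume_Ico]
    fun_prop
  simp_rw [ofReal_sq_sub_eq_volume]
  rw [lintegral_add_left hmeas, lintegral_volume_Ico_prod measurable_fst measurable_snd,
    lintegral_volume_Ico_prod measurable_snd measurable_fst]

/-- A union bound: `{X ≤ s}` is covered by `{X ≤ s, t < Y}` and `{Y ≤ t}`. The bound depends on the
marginals only, and the comonotone coupling attains it. -/
lemma ofReal_cdf_sub_le {Ω : Type*} [MeasurableSpace Ω] {π : Measure Ω} {X Y : Ω → ℝ}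
    {F G : Measure ℝ} [IsProbabilityMeasure F] [IsProbabilityMeasure G]
    (hX : Measurable X) (hY : Measurable Y)
    (hF : π.map X = F) (hG : π.map Y = G) (s t : ℝ) :
    ENNReal.ofReal (cdf F s - cdf G t) ≤ π {z | X z ≤ s ∧ t < Y z} := by
  rw [ENNReal.ofReal_sub _ (cdf_nonneg _ _), ofReal_cdf, ofReal_cdf, tsub_le_iff_right, ← hF, ← hG,
    Measure.map_apply hX measurableSet_Iic, Measure.map_apply hY measurableSet_Iic]
  refine (measure_mono fun z hz => ?_).trans (measure_union_le _ _)
  by_cases h : t < Y z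
  · exact Or.inl ⟨hz, h⟩
  · exact Or.inr (not_lt.1 h)

lemma unif_quantile_le_lt (F G : Measure ℝ) [IsProbabilityMeasure F] [IsProbabilityMeasure G]
    (s t : ℝ) :
    unif {u | quantile F u ≤ s ∧ t < quantile G u} = ENNReal.ofReal (cdf F s - cdf G t) := by
  rw [← unif_Ioc (cdf_nonneg G t) (cdf_le_one F s)]
  refine measure_congr ?_
  filter_upwards [ae_unif_mem] with u hu
  refine propext ?_
  change quantile F u ≤ s ∧ t < quantile G u ↔ cdf G t < u ∧ u ≤ cdf F s
  rw [quantile_le_iff F hu, lt_quantile_iff G hu, and_comm]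

/-- In dimension one the comonotone coupling is optimal for the quadratic cost. -/
lemma wasserstein_eq (F G : Measure ℝ) [IsProbabilityMeasure F] [IsProbabilityMeasure G] :
    wasserstein F G =
      (∫⁻ u, ENNReal.ofReal ((quantile F u - quantile G u) ^ 2) ∂unif) ^ (1 / 2 : ℝ) := by
  have hFm := aemeasurable_quantile F
  have hGm := aemeasurable_quantile G
  have hm := hFm.prodMk hGm
  set π₀ := unif.map fun u => (quantile F u, quantile G u) with hπ₀
  have h0 : ∫⁻ z, ENNReal.ofReal ((z.1 - z.2) ^ 2) ∂π₀ =
      ∫⁻ u, ENNReal.ofReal ((quantile F u - quantile G u) ^ 2) ∂unif := by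
    rw [hπ₀, lintegral_map' (by fun_prop) hm]
  have hfst : π₀.map Prod.fst = F := by
    rw [hπ₀, AEMeasurable.map_map_of_aemeasurable measurable_fst.aemeasurable hm]
    exact map_quantile F
  have hsnd : π₀.map Prod.snd = G := by
    rw [hπ₀, AEMeasurable.map_map_of_aemeasurable measurable_snd.aemeasurable hm]
    exact map_quantile G
  have : IsProbabilityMeasure π₀ := Measure.isProbabilityMeasure_map hm
  rw [← h0]
  refine le_antisymm (iInf₂_le π₀ ⟨hfst, hsnd⟩) (le_iInf₂ fun π hπ => ?_)
  have : IsProbabilityMeasure π := by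
    refine ⟨?_⟩
    have h1 := congrArg (fun μ => μ univ) hπ.1
    simpa [Measure.map_apply measurable_fst] using h1
  refine ENNReal.rpow_le_rpow ?_ (by norm_num)
  rw [lintegral_sq_sub_eq, lintegral_sq_sub_eq]
  refine add_le_add (lintegral_mono fun p => ?_) (lintegral_mono fun p => ?_)
  · refine le_trans (le_of_eq ?_)
      (ofReal_cdf_sub_le measurable_fst measurable_snd hπ.1 hπ.2 _ _)
    rw [← unif_quantile_le_lt, hπ₀]
    exact Measure.map_apply_of_aemeasurable hm
      (measurableSet_le_and_lt measurable_fst measurable_const measurable_const measurable_snd)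
  · refine le_trans (le_of_eq ?_)
      (ofReal_cdf_sub_le measurable_snd measurable_fst hπ.2 hπ.1 _ _)
    rw [← unif_quantile_le_lt, hπ₀]
    exact Measure.map_apply_of_aemeasurable hm
      (measurableSet_le_and_lt measurable_snd measurable_const measurable_const measurable_fst)

end Coupling

/-! ### Moments and distances in `L²(0,1)` -/

section SquareIntegrable

lemma memLp_quantile {G : Measure ℝ} (hG : G ∈ M2) : MemLp (quantile G) 2 unif := by
  have := hG.1
  have h := hG.2
  rw [← map_quantile G] at h
  exact (memLp_map_measure_iff (by fun_prop) (aemeasurable_quantile G)).1 h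

lemma mean_eq_integral_quantile (G : Measure ℝ) [IsProbabilityMeasure G] :
    mean G = ∫ u, quantile G u ∂unif := by
  conv_lhs => rw [mean, ← map_quantile G]
  exact integral_map (aemeasurable_quantile G) (by fun_prop)

lemma sd_sq_eq_variance_quantile (G : Measure ℝ) [IsProbabilityMeasure G] :
    sd G ^ 2 = Var[quantile G; unif] := by
  rw [sd, std, Real.sq_sqrt (variance_nonneg _ _)]
  conv_lhs => rw [← map_quantile G]
  exact variance_id_map (aemeasurable_quantile G)

lemma lawOf_mem_M2 {h : ℝ → ℝ} (hh : MemLp h 2 unif) : lawOf h ∈ M2 :=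
  ⟨Measure.isProbabilityMeasure_map hh.aemeasurable,
    (memLp_map_measure_iff (by fun_prop) hh.aemeasurable).2 hh⟩

lemma mean_lawOf {h : ℝ → ℝ} (hh : MemLp h 2 unif) : mean (lawOf h) = ∫ u, h u ∂unif :=
  integral_map hh.aemeasurable (by fun_prop)

lemma sd_lawOf {h : ℝ → ℝ} (hh : MemLp h 2 unif) : sd (lawOf h) = √(Var[h; unif]) := by
  rw [sd, std, lawOf, variance_id_map hh.aemeasurable]

variable {Ω : Type*} [MeasurableSpace Ω] {P : Measure Ω} {X Y : Ω → ℝ}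

lemma ae_eq_of_integral_sq_sub_nonpos (hX : MemLp X 2 P) (hY : MemLp Y 2 P)
    (h : ∫ ω, (X ω - Y ω) ^ 2 ∂P ≤ 0) : X =ᵐ[P] Y := by
  have h0 : ∫ ω, (X ω - Y ω) ^ 2 ∂P = 0 :=
    le_antisymm h (integral_nonneg fun ω => sq_nonneg _)
  have hae := (integral_eq_zero_iff_of_nonneg (fun ω => sq_nonneg _)
    (hX.sub hY).integrable_sq).1 h0
  filter_upwards [hae] with ω hω
  exact sub_eq_zero.1 (pow_eq_zero_iff (two_ne_zero)|>.1 hω)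

variable [IsProbabilityMeasure P]

lemma integral_sq_sub_eq_variance (hX : MemLp X 2 P) (hY : MemLp Y 2 P) :
    ∫ ω, (X ω - Y ω) ^ 2 ∂P =
      Var[X; P] - 2 * cov[X, Y; P] + Var[Y; P] + (∫ ω, X ω ∂P - ∫ ω, Y ω ∂P) ^ 2 := by
  have h := variance_eq_sub (hX.sub hY)
  rw [variance_sub hX hY] at h
  have hi : ∫ ω, (X - Y) ω ∂P = ∫ ω, X ω ∂P - ∫ ω, Y ω ∂P :=
    integral_sub (hX.integrable (by norm_num)) (hY.integrable (by norm_num))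
  rw [hi] at h
  have h2 : ∫ ω, ((X - Y) ^ 2) ω ∂P = ∫ ω, (X ω - Y ω) ^ 2 ∂P := rfl
  rw [h2] at h
  linarith

lemma integral_sub_sub_add_const {A : Ω → ℝ} (iA : Integrable A P)
    (iX : Integrable X P) (iY : Integrable Y P) (a b d : ℝ) :
    ∫ ω, (A ω - a * X ω - b * Y ω + d) ∂P =
      ∫ ω, A ω ∂P - a * ∫ ω, X ω ∂P - b * ∫ ω, Y ω ∂P + d := by
  have i1 : Integrable (fun ω => A ω - a * X ω) P := iA.sub (iX.const_mul _)
  have i2 : Integrable (fun ω => A ω - a * X ω - b * Y ω) P := i1.sub (iY.const_mul _)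
  rw [integral_add i2 (integrable_const _), integral_sub i1 (iY.const_mul _),
    integral_sub iA (iX.const_mul _), integral_const_mul, integral_const_mul]
  simp

/-- Chebyshev's association inequality. -/
lemma covariance_nonneg_of_monotoneOn {X Y : ℝ → ℝ} (hX : MemLp X 2 unif) (hY : MemLp Y 2 unif)
    (hXm : MonotoneOn X (Ioo 0 1)) (hYm : MonotoneOn Y (Ioo 0 1)) : 0 ≤ cov[X, Y; unif] := by
  have iX := hX.integrable (by norm_num : (1 : ℝ≥0∞) ≤ 2)
  have iY := hY.integrable (by norm_num : (1 : ℝ≥0∞) ≤ 2)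
  have iXY : Integrable (fun u => X u * Y u) unif := hX.integrable_mul hY
  have hpt : ∀ u ∈ Ioo (0 : ℝ) 1, ∀ v ∈ Ioo (0 : ℝ) 1, 0 ≤ (X u - X v) * (Y u - Y v) := by
    intro u hu v hv
    rcases le_total u v with h | h
    · exact mul_nonneg_of_nonpos_of_nonpos (sub_nonpos.2 (hXm hu hv h))
        (sub_nonpos.2 (hYm hu hv h))
    · exact mul_nonneg (sub_nonneg.2 (hXm hv hu h)) (sub_nonneg.2 (hYm hv hu h))
  -- Integrating the non-negative product over `u` and then over `v` gives twice the covariance.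
  have hinner : ∀ v, ∫ u, (X u - X v) * (Y u - Y v) ∂unif =
      ∫ u, X u * Y u ∂unif - Y v * ∫ u, X u ∂unif - X v * ∫ u, Y u ∂unif + X v * Y v := by
    intro v
    rw [← integral_sub_sub_add_const iXY iX iY]
    exact integral_congr_ae (ae_of_all _ fun u => by ring)
  have hnn : 0 ≤ ∫ v, ∫ u, (X u - X v) * (Y u - Y v) ∂unif ∂unif := by
    refine integral_nonneg_of_ae ?_
    filter_upwards [ae_unif_mem] with v hv
    refine integral_nonneg_of_ae ?_
    filter_upwards [ae_unif_mem] with u hu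
    exact hpt u hu v hv
  have houter : ∫ v, ∫ u, (X u - X v) * (Y u - Y v) ∂unif ∂unif =
      ∫ v, (X v * Y v - (∫ u, Y u ∂unif) * X v - (∫ u, X u ∂unif) * Y v
        + ∫ u, X u * Y u ∂unif) ∂unif :=
    integral_congr_ae (ae_of_all _ fun v => by simp only [hinner]; ring)
  rw [houter, integral_sub_sub_add_const iXY iX iY] at hnn
  rw [covariance_eq_sub hX hY]
  have e : ∫ u, (X * Y) u ∂unif = ∫ u, X u * Y u ∂unif := rfl
  rw [e]
  linarith

/-- The quadratic Wasserstein distance is the `L²` distance of the quantile functions. -/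
lemma wasserstein_eq_ofReal {F G : Measure ℝ} (hF : F ∈ M2) (hG : G ∈ M2) :
    wasserstein F G = ENNReal.ofReal (√(∫ u, (quantile F u - quantile G u) ^ 2 ∂unif)) := by
  have := hF.1
  have := hG.1
  have h0 : 0 ≤ ∫ u, (quantile F u - quantile G u) ^ 2 ∂unif :=
    integral_nonneg fun u => sq_nonneg _
  rw [wasserstein_eq, Real.sqrt_eq_rpow, ← ENNReal.ofReal_rpow_of_nonneg h0 (by norm_num)]
  congr 1
  exact (ofReal_integral_eq_lintegral_ofReal
    ((memLp_quantile hF).sub (memLp_quantile hG)).integrable_sq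
    (ae_of_all _ fun u => sq_nonneg _)).symm

lemma wasserstein_le_iff {F G : Measure ℝ} (hF : F ∈ M2) (hG : G ∈ M2) {ε : ℝ} (hε : 0 ≤ ε) :
    wasserstein F G ≤ ENNReal.ofReal (√ε) ↔
      ∫ u, (quantile F u - quantile G u) ^ 2 ∂unif ≤ ε := by
  rw [wasserstein_eq_ofReal hF hG, ENNReal.ofReal_le_ofReal_iff (Real.sqrt_nonneg _),
    Real.sqrt_le_sqrt_iff hε]

lemma wasserstein_eq_iff {F G : Measure ℝ} (hF : F ∈ M2) (hG : G ∈ M2) {ε : ℝ} (hε : 0 ≤ ε) :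
    wasserstein F G = ENNReal.ofReal (√ε) ↔
      ∫ u, (quantile F u - quantile G u) ^ 2 ∂unif = ε := by
  rw [wasserstein_eq_ofReal hF hG,
    ENNReal.ofReal_eq_ofReal_iff (Real.sqrt_nonneg _) (Real.sqrt_nonneg _),
    Real.sqrt_inj (integral_nonneg fun u => sq_nonneg _) hε]

lemma wasserstein_lawOf_eq_iff {F : Measure ℝ} (hF : F ∈ M2) {h : ℝ → ℝ} (hh : MemLp h 2 unif)
    (hm : MonotoneOn h (Ioo 0 1)) {ε : ℝ} (hε : 0 ≤ ε) :
    wasserstein F (lawOf h) = ENNReal.ofReal (√ε) ↔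
      ∫ u, (quantile F u - h u) ^ 2 ∂unif = ε := by
  rw [wasserstein_eq_iff hF (lawOf_mem_M2 hh) hε]
  have : ∫ u, (quantile F u - quantile (lawOf h) u) ^ 2 ∂unif =
      ∫ u, (quantile F u - h u) ^ 2 ∂unif := by
    refine integral_congr_ae ?_
    filter_upwards [ae_quantile_lawOf hm] with u hu
    rw [hu]
  rw [this]

end SquareIntegrable

/-! ### The weight function -/

section Weight

variable {g : ℝ → ℝ}

lemma derivWithin_Iic_eq_Iio (f : ℝ → ℝ) (x : ℝ) :
    derivWithin f (Iic x) x = derivWithin f (Iio x) x := by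
  have hiff := fun f' => hasDerivWithinAt_Iio_iff_Iic (f := f) (f' := f') (x := x)
  by_cases H : DifferentiableWithinAt ℝ f (Iio x) x
  · exact ((hiff _).1 H.hasDerivWithinAt).derivWithin (uniqueDiffOn_Iic x x self_mem_Iic)
  · rw [derivWithin_zero_of_not_differentiableWithinAt H,
      derivWithin_zero_of_not_differentiableWithinAt]
    exact fun H' => H ((hiff _).2 H'.hasDerivWithinAt).differentiableWithinAt

/-- The left derivative of a concave function decreases, and the reflection `u ↦ 1 - u` reverses
this. -/
lemma monotoneOn_weight (hconc : ConcaveOn ℝ (Icc 0 1) g) : MonotoneOn (weight g) (Ioo 0 1) := by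
  have hmem : ∀ {u : ℝ}, u ∈ Ioo (0 : ℝ) 1 → 1 - u ∈ interior (Icc (0 : ℝ) 1) := by
    intro u hu
    rw [interior_Icc]
    exact ⟨by linarith [hu.2], by linarith [hu.1]⟩
  intro u hu v hv huv
  have h := hconc.neg.monotoneOn_leftDeriv (hmem hv) (hmem hu) (by linarith)
  simp only [weight, derivWithin_Iic_eq_Iio]
  beta_reduce at h
  rwa [derivWithin.neg, derivWithin.neg, neg_le_neg_iff] at h

lemma cdf_dirac_one (x : ℝ) : cdf (Measure.dirac (1 : ℝ)) x = if 1 ≤ x then 1 else 0 := by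
  rw [cdf_eq_real, Measure.real, Measure.dirac_apply' _ measurableSet_Iic]
  by_cases h : 1 ≤ x <;> simp [h]

lemma quantile_dirac_one {u : ℝ} (hu : u ∈ Ioo (0 : ℝ) 1) :
    quantile (Measure.dirac (1 : ℝ)) u = 1 := by
  refine eq_of_forall_ge_iff fun x => ?_
  rw [quantile_le_iff _ hu, cdf_dirac_one]
  split_ifs with h
  · exact iff_of_true hu.2.le h
  · exact iff_of_false (not_le.2 hu.1) h

lemma riskMeasure_dirac_one (hg : IsDistortion g) : riskMeasure g (Measure.dirac 1) = 1 := by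
  have h1 : ∫⁻ x in Ioi (0 : ℝ), ENNReal.ofReal (g (1 - cdf (Measure.dirac (1 : ℝ)) x)) = 1 := by
    have e : ∀ x : ℝ, ENNReal.ofReal (g (1 - cdf (Measure.dirac (1 : ℝ)) x)) =
        (Iio (1 : ℝ)).indicator 1 x := by
      intro x
      rw [cdf_dirac_one]
      by_cases h : 1 ≤ x
      · simp [h, hg.zero]
      · simp [h, hg.one, not_le.1 h]
    simp_rw [e]
    rw [lintegral_indicator_one measurableSet_Iio, Measure.restrict_apply measurableSet_Iio,
      inter_comm, Ioi_inter_Iio, Real.volume_Ioo]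
    simp
  have h2 : ∫⁻ x in Iio (0 : ℝ),
      ENNReal.ofReal (1 - g (1 - cdf (Measure.dirac (1 : ℝ)) x)) = 0 := by
    have e : ∀ x ∈ Iio (0 : ℝ),
        ENNReal.ofReal (1 - g (1 - cdf (Measure.dirac (1 : ℝ)) x)) = 0 := by
      intro x hx
      rw [cdf_dirac_one, if_neg (not_le.2 (lt_trans hx one_pos))]
      simp [hg.one]
    rw [setLIntegral_congr_fun measurableSet_Iio e]
    simp
  rw [riskMeasure, h1, h2]
  simp

/-- The point mass at `1` has risk `1` and constant quantile function `1`. -/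
lemma integral_weight (hg : IsDistortion g) (hrepr : HasWeightRepresentation g) :
    ∫ u, weight g u ∂unif = 1 := by
  have hm : Measure.dirac (1 : ℝ) ∈ M2 :=
    ⟨inferInstance, (memLp_const (1 : ℝ)).ae_eq (ae_eq_dirac id).symm⟩
  have h := hrepr.repr _ hm
  rw [riskMeasure_dirac_one hg] at h
  have e : ∫ u, weight g u * quantile (Measure.dirac 1) u ∂unif = ∫ u, weight g u ∂unif := by
    refine integral_congr_ae ?_
    filter_upwards [ae_unif_mem] with u hu
    rw [quantile_dirac_one hu, mul_one]
  rw [e] at h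
  exact_mod_cast h.symm

lemma exists_mem_Ioo_of_ae {p : ℝ → Prop} (hp : ∀ᵐ u ∂unif, p u) {s t : ℝ} (hs : 0 ≤ s)
    (ht : t ≤ 1) (hst : s < t) : ∃ u ∈ Ioo s t, p u := by
  by_contra! hcon
  have h0 : unif (Ioo s t) = 0 := measure_mono_null hcon (ae_iff.1 hp)
  rw [unif, Measure.restrict_apply measurableSet_Ioo, inter_eq_left.2 (Ioo_subset_Ioo hs ht),
    Real.volume_Ioo, ENNReal.ofReal_eq_zero] at h0
  linarith

/-- Zero variance only gives `γ = 1` almost everywhere. Monotonicity upgrades this to every point,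
by squeezing between good points on either side. -/
lemma varWeight_pos (hg : IsDistortion g) (hconc : ConcaveOn ℝ (Icc 0 1) g)
    (hrepr : HasWeightRepresentation g) (hne : ∃ u ∈ Ioo (0 : ℝ) 1, weight g u ≠ 1) :
    0 < varWeight g := by
  refine lt_of_le_of_ne (variance_nonneg _ _) fun h0 => ?_
  have hae := ae_eq_integral_of_variance_eq_zero hrepr.memLp h0.symm
  have hm := monotoneOn_weight hconc
  obtain ⟨u, hu, hne⟩ := hne
  obtain ⟨v, hv, hv1⟩ := exists_mem_Ioo_of_ae hae le_rfl hu.2.le hu.1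
  obtain ⟨w, hw, hw1⟩ := exists_mem_Ioo_of_ae hae hu.1.le le_rfl hu.2
  rw [integral_weight hg hrepr] at hv1 hw1
  refine hne (le_antisymm ?_ ?_)
  · rw [← hw1]
    exact hm hu ⟨hu.1.trans hw.1, hw.2⟩ hw.1.le
  · rw [← hv1]
    exact hm ⟨hv.1, hv.2.trans hu.2⟩ hu hv.2.le

end Weight

lemma covariance_add_const_mul_right {Ω : Type*} [MeasurableSpace Ω] {P : Measure Ω}
    [IsFiniteMeasure P] {X Y Z : Ω → ℝ} (hX : MemLp X 2 P) (hY : MemLp Y 2 P) (hZ : MemLp Z 2 P)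
    (l : ℝ) : cov[X, fun ω => Y ω + l * Z ω; P] = cov[X, Y; P] + l * cov[X, Z; P] := by
  rw [← covariance_const_mul_right]
  exact covariance_add_right hX hY (hZ.const_mul l)

lemma variance_add_const_mul {Ω : Type*} [MeasurableSpace Ω] {P : Measure Ω}
    [IsFiniteMeasure P] {Y Z : Ω → ℝ} (hY : MemLp Y 2 P) (hZ : MemLp Z 2 P) (l : ℝ) :
    Var[fun ω => Y ω + l * Z ω; P] = Var[Y; P] + 2 * l * cov[Y, Z; P] + l ^ 2 * Var[Z; P] := by
  rw [variance_fun_add hY (hZ.const_mul l), covariance_const_mul_right, variance_const_mul]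
  ring

/-! ### The functions `h_l` -/

section Projection

variable {g : ℝ → ℝ} {F : Measure ℝ} {μ σ l : ℝ}

lemma std_tilted_sq (hrepr : HasWeightRepresentation g) (hF : F ∈ M2) (l : ℝ) :
    std (tilted g F l) unif ^ 2 = varWeight g + 2 * l * covWeight g F + l ^ 2 * sd F ^ 2 := by
  have := hF.1
  rw [std, Real.sq_sqrt (variance_nonneg _ _), sd_sq_eq_variance_quantile, covWeight,
    covariance_comm]
  exact variance_add_const_mul hrepr.memLp (memLp_quantile hF) l

lemma memLp_tilted (hrepr : HasWeightRepresentation g) (hF : F ∈ M2) (l : ℝ) :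
    MemLp (tilted g F l) 2 unif :=
  hrepr.memLp.add ((memLp_quantile hF).const_mul l)

lemma hFun_eq (g : ℝ → ℝ) (F : Measure ℝ) (μ σ l : ℝ) :
    hFun g F μ σ l = fun u => (μ - σ / std (tilted g F l) unif * ∫ v, tilted g F l v ∂unif) +
      σ / std (tilted g F l) unif * tilted g F l u := by
  ext u
  rw [hFun]
  ring

lemma memLp_hFun (hrepr : HasWeightRepresentation g) (hF : F ∈ M2) :
    MemLp (hFun g F μ σ l) 2 unif := by
  rw [hFun_eq]
  exact MemLp.add (memLp_const (_ : ℝ)) ((memLp_tilted hrepr hF l).const_mul (_ : ℝ))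

lemma integral_hFun (hrepr : HasWeightRepresentation g) (hF : F ∈ M2) :
    ∫ u, hFun g F μ σ l u ∂unif = μ := by
  have hi := (memLp_tilted hrepr hF l).integrable (by norm_num)
  rw [hFun_eq, integral_add (integrable_const _) (hi.const_mul _), integral_const_mul]
  simp

lemma covariance_hFun (X : ℝ → ℝ) (hrepr : HasWeightRepresentation g)
    (hF : F ∈ M2) :
    cov[X, hFun g F μ σ l; unif] =
      σ / std (tilted g F l) unif * cov[X, tilted g F l; unif] := by
  have hi := (memLp_tilted hrepr hF l).integrable (by norm_num)
  rw [hFun_eq, covariance_const_add_right (hi.const_mul _), covariance_const_mul_right]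

lemma covariance_tilted {X : ℝ → ℝ} (hX : MemLp X 2 unif) (hrepr : HasWeightRepresentation g)
    (hF : F ∈ M2) (l : ℝ) :
    cov[X, tilted g F l; unif] = cov[X, weight g; unif] + l * cov[X, quantile F; unif] :=
  covariance_add_const_mul_right hX hrepr.memLp (memLp_quantile hF) l

lemma variance_hFun (hrepr : HasWeightRepresentation g) (hF : F ∈ M2)
    (hb : std (tilted g F l) unif ≠ 0) : Var[hFun g F μ σ l; unif] = σ ^ 2 := by
  have hm := memLp_tilted hrepr hF l
  rw [hFun_eq, variance_const_add (hm.aestronglyMeasurable.const_mul _), variance_const_mul]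
  have h2 : Var[tilted g F l; unif] = std (tilted g F l) unif ^ 2 := by
    rw [std, Real.sq_sqrt (variance_nonneg _ _)]
  rw [h2]
  field_simp

lemma monotoneOn_hFun (hconc : ConcaveOn ℝ (Icc 0 1) g) [IsProbabilityMeasure F] (hσ : 0 ≤ σ)
    (hl : 0 ≤ l) : MonotoneOn (hFun g F μ σ l) (Ioo 0 1) := by
  intro u hu v hv huv
  have h1 := monotoneOn_weight hconc hu hv huv
  have h2 := mul_le_mul_of_nonneg_left (monotoneOn_quantile F hu hv huv) hl
  have hb : 0 ≤ σ / std (tilted g F l) unif := div_nonneg hσ (Real.sqrt_nonneg _)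
  rw [hFun_eq]
  exact add_le_add_right (mul_le_mul_of_nonneg_left (add_le_add h1 h2) hb) _

lemma continuousWithinAt_hFun [IsProbabilityMeasure F] {u : ℝ} (hu : u ∈ Ioo (0 : ℝ) 1)
    (hc : ContinuousAt (weight g) u) : ContinuousWithinAt (hFun g F μ σ l) (Iio u) u := by
  rw [hFun_eq]
  exact continuousWithinAt_const.add (continuousWithinAt_const.mul
    (hc.continuousWithinAt.add
      (continuousWithinAt_const.mul (continuousWithinAt_quantile F hu))))

end Projection

/-! ### The unique maximiser -/

section WorstCase

variable {g : ℝ → ℝ} {F : Measure ℝ} {c : ℝ}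

/-- The quantile function `F⁻¹ + c γ`. -/
noncomputable def shifted (g : ℝ → ℝ) (F : Measure ℝ) (c u : ℝ) : ℝ := quantile F u + c * weight g u

lemma memLp_shifted (hrepr : HasWeightRepresentation g) (hF : F ∈ M2) (c : ℝ) :
    MemLp (shifted g F c) 2 unif :=
  (memLp_quantile hF).add (hrepr.memLp.const_mul c)

lemma monotoneOn_shifted (hconc : ConcaveOn ℝ (Icc 0 1) g) [IsProbabilityMeasure F]
    (hc : 0 ≤ c) : MonotoneOn (shifted g F c) (Ioo 0 1) := fun _ hu _ hv huv =>
  add_le_add (monotoneOn_quantile F hu hv huv)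
    (mul_le_mul_of_nonneg_left (monotoneOn_weight hconc hu hv huv) hc)

lemma integral_shifted (hg : IsDistortion g) (hrepr : HasWeightRepresentation g) (hF : F ∈ M2)
    (c : ℝ) : ∫ u, shifted g F c u ∂unif = mean F + c := by
  have := hF.1
  have i1 := (memLp_quantile hF).integrable (by norm_num)
  have i2 := hrepr.memLp.integrable (by norm_num)
  simp only [shifted]
  rw [integral_add i1 (i2.const_mul c), integral_const_mul, integral_weight hg hrepr,
    mean_eq_integral_quantile, mul_one]

lemma variance_shifted (hrepr : HasWeightRepresentation g) (hF : F ∈ M2) (c : ℝ) :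
    Var[shifted g F c; unif] = sd F ^ 2 + 2 * c * covWeight g F + c ^ 2 * varWeight g := by
  have := hF.1
  rw [sd_sq_eq_variance_quantile]
  exact variance_add_const_mul (memLp_quantile hF) hrepr.memLp c

lemma covariance_quantile_shifted (hrepr : HasWeightRepresentation g) (hF : F ∈ M2) (c : ℝ) :
    cov[quantile F, shifted g F c; unif] = sd F ^ 2 + c * covWeight g F := by
  have := hF.1
  have h := covariance_add_const_mul_right (memLp_quantile hF) (memLp_quantile hF) hrepr.memLp c
  rw [covariance_self (memLp_quantile hF).aemeasurable, ← sd_sq_eq_variance_quantile] at h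
  exact h

lemma integral_weight_sq (hg : IsDistortion g) (hrepr : HasWeightRepresentation g) :
    ∫ u, weight g u ^ 2 ∂unif = 1 + varWeight g := by
  rw [varWeight, variance_eq_sub hrepr.memLp, integral_weight hg hrepr]
  simp

lemma covWeight_nonneg (hconc : ConcaveOn ℝ (Icc 0 1) g) (hrepr : HasWeightRepresentation g)
    (hF : F ∈ M2) : 0 ≤ covWeight g F := by
  have := hF.1
  exact covariance_nonneg_of_monotoneOn (memLp_quantile hF) hrepr.memLp (monotoneOn_quantile F)
    (monotoneOn_weight hconc)

/-- Expand the square of `(Z - F⁻¹) - c γ`. This is Cauchy–Schwarz with its defect kept: the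
subtracted square yields both optimality and uniqueness. -/
lemma two_mul_integral_weight_gap (hg : IsDistortion g) (hrepr : HasWeightRepresentation g)
    (hF : F ∈ M2) {Z : ℝ → ℝ} (hZ : MemLp Z 2 unif) (c : ℝ) :
    2 * c * (∫ u, weight g u * Z u ∂unif - ∫ u, weight g u * quantile F u ∂unif) =
      ∫ u, (quantile F u - Z u) ^ 2 ∂unif + c ^ 2 * (1 + varWeight g)
        - ∫ u, (Z u - shifted g F c u) ^ 2 ∂unif := by
  have hq := memLp_quantile hF
  have hw := hrepr.memLp
  have i1 : Integrable (fun u => (quantile F u - Z u) ^ 2) unif := (hq.sub hZ).integrable_sq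
  have i2 : Integrable (fun u => c ^ 2 * weight g u ^ 2) unif := hw.integrable_sq.const_mul _
  have h := integral_sub_sub_add_const (i1.add i2) (hw.integrable_mul hZ) (hw.integrable_mul hq)
    (2 * c) (-(2 * c)) 0
  have e : ∫ u, (Z u - shifted g F c u) ^ 2 ∂unif =
      ∫ u, (((fun u => (quantile F u - Z u) ^ 2) + fun u => c ^ 2 * weight g u ^ 2) u
        - 2 * c * (weight g * Z) u - -(2 * c) * (weight g * quantile F) u + 0) ∂unif := by
    refine integral_congr_ae (ae_of_all _ fun u => ?_)
    simp only [shifted, Pi.add_apply, Pi.mul_apply]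
    ring
  have e2 : ∫ u, ((fun u => (quantile F u - Z u) ^ 2) + fun u => c ^ 2 * weight g u ^ 2) u ∂unif =
      ∫ u, (quantile F u - Z u) ^ 2 ∂unif + c ^ 2 * (1 + varWeight g) := by
    rw [← integral_weight_sq hg hrepr, ← integral_const_mul]
    exact integral_add i1 i2
  rw [e, h, e2]
  simp only [Pi.mul_apply]
  ring

lemma integral_quantile_sub_shifted_sq (hg : IsDistortion g) (hrepr : HasWeightRepresentation g)
    (c : ℝ) :
    ∫ u, (quantile F u - shifted g F c u) ^ 2 ∂unif = c ^ 2 * (1 + varWeight g) := by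
  rw [← integral_weight_sq hg hrepr, ← integral_const_mul]
  exact integral_congr_ae (ae_of_all _ fun u => by simp only [shifted]; ring)

lemma integral_weight_mul_quantile_lawOf {h : ℝ → ℝ}
    (hm : MonotoneOn h (Ioo 0 1)) :
    ∫ u, weight g u * quantile (lawOf h) u ∂unif = ∫ u, weight g u * h u ∂unif := by
  refine integral_congr_ae ?_
  filter_upwards [ae_quantile_lawOf hm] with u hu
  rw [hu]

lemma isWorstCase_lawOf_shifted (hg : IsDistortion g) (hconc : ConcaveOn ℝ (Icc 0 1) g)
    (hrepr : HasWeightRepresentation g) (hF : F ∈ M2) {ε : ℝ} (hc : 0 < c)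
    (hcε : c ^ 2 * (1 + varWeight g) = ε) (hε : 0 ≤ ε) :
    IsWorstCase g F ε (lawOf (shifted g F c)) ∧
      ∀ G, IsWorstCase g F ε G → G = lawOf (shifted g F c) := by
  have := hF.1
  have hsL := memLp_shifted hrepr hF c
  have hsm : MonotoneOn (shifted g F c) (Ioo 0 1) := monotoneOn_shifted hconc hc.le
  have hM2 := lawOf_mem_M2 hsL
  have hball : lawOf (shifted g F c) ∈ wassersteinBall F ε :=
    ⟨hM2, ((wasserstein_lawOf_eq_iff hF hsL hsm hε).2
      ((integral_quantile_sub_shifted_sq hg hrepr c).trans hcε)).le⟩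
  -- At `Z = F⁻¹ + c γ` the defect vanishes and the whole budget `ε` is spent; subtracting this case
  -- from that of a general `G` gives `hgap`.
  have hopt := two_mul_integral_weight_gap hg hrepr hF hsL c
  rw [integral_quantile_sub_shifted_sq hg hrepr c, hcε] at hopt
  simp only [sub_self, ne_eq, OfNat.ofNat_ne_zero, not_false_eq_true, zero_pow,
    integral_zero, sub_zero] at hopt
  have hgap : ∀ G ∈ wassersteinBall F ε,
      2 * c * (∫ u, weight g u * quantile G u ∂unif) ≤
        2 * c * (∫ u, weight g u * shifted g F c u ∂unif)
          - ∫ u, (quantile G u - shifted g F c u) ^ 2 ∂unif := by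
    intro G hG
    have h1 := two_mul_integral_weight_gap hg hrepr hF (memLp_quantile hG.1) c
    have h2 := (wasserstein_le_iff hF hG.1 hε).1 hG.2
    rw [hcε] at h1
    linarith
  have hval : riskMeasure g (lawOf (shifted g F c)) =
      ((∫ u, weight g u * shifted g F c u ∂unif : ℝ) : EReal) := by
    rw [hrepr.repr _ hM2, integral_weight_mul_quantile_lawOf hsm]
  refine ⟨⟨hball, fun G hG => ?_⟩, fun G hG => ?_⟩
  · rw [hval, hrepr.repr _ hG.1, EReal.coe_le_coe_iff]
    have h0 : 0 ≤ ∫ u, (quantile G u - shifted g F c u) ^ 2 ∂unif :=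
      integral_nonneg fun u => sq_nonneg _
    exact le_of_mul_le_mul_left (by linarith [hgap G hG]) (by positivity : 0 < 2 * c)
  · have := hG.1.1.1
    have hle := hG.2 _ hball
    rw [hval, hrepr.repr _ hG.1.1, EReal.coe_le_coe_iff] at hle
    -- Another maximiser has at least the same value, which forces its defect to be zero.
    have h2 := mul_le_mul_of_nonneg_left hle (by positivity : 0 ≤ 2 * c)
    have hae := ae_eq_of_integral_sq_sub_nonpos (memLp_quantile hG.1.1) hsL
      (by linarith [hgap G hG.1])
    rw [← map_quantile G, lawOf]
    exact Measure.map_congr hae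

end WorstCase

/-! ### Gram determinant identities -/

section Algebra

variable {S C V c l σ b : ℝ}

/-- Both sides are non-negative, so squares may be compared. Their difference factors through the
Gram determinant `V S - C²` and `c l - 1`, with a remaining factor that is positive. Here `S`, `V`,
`C` stand for the variances and covariance of `F⁻¹` and `γ`. -/
lemma mul_eq_mul_iff_of_sq_eq (hS : 0 < S) (hC : 0 ≤ C) (hc : 0 < c) (hl : 0 ≤ l)
    (hσ : 0 ≤ σ) (hb : 0 ≤ b) (hσ2 : σ ^ 2 = S + 2 * c * C + c ^ 2 * V)
    (hb2 : b ^ 2 = V + 2 * l * C + l ^ 2 * S) :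
    σ * (C + l * S) = (S + c * C) * b ↔ V * S - C ^ 2 = 0 ∨ c * l = 1 := by
  have h1 : 0 ≤ σ * (C + l * S) := by positivity
  have h2 : 0 ≤ (S + c * C) * b := by positivity
  have key : (σ * (C + l * S)) ^ 2 - ((S + c * C) * b) ^ 2 =
      (V * S - C ^ 2) * (c * l - 1) * (2 * c * C + S * (c * l + 1)) := by
    rw [mul_pow, mul_pow, hσ2, hb2]
    ring
  have h3 : 2 * c * C + S * (c * l + 1) ≠ 0 := by positivity
  rw [← sq_eq_sq₀ h1 h2, ← sub_eq_zero, key, mul_eq_zero, or_iff_left h3, mul_eq_zero,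
    sub_eq_zero (a := c * l)]

/-- Equality in Cauchy–Schwarz for `F⁻¹ + c γ` and `γ + l F⁻¹`: the defect is `(1 - c l)² (V S -
C²)`, the squared determinant of the change of vectors times the Gram determinant. -/
lemma add_eq_mul_of_sq_eq (hS : 0 < S) (hC : 0 ≤ C) (hV : 0 < V) (hc : 0 < c) (hl : 0 ≤ l)
    (hσ : 0 ≤ σ) (hb : 0 ≤ b) (hσ2 : σ ^ 2 = S + 2 * c * C + c ^ 2 * V)
    (hb2 : b ^ 2 = V + 2 * l * C + l ^ 2 * S) (h : V * S - C ^ 2 = 0 ∨ c * l = 1) :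
    C + c * V + l * (S + c * C) = σ * b := by
  have h1 : 0 ≤ C + c * V + l * (S + c * C) := by positivity
  rw [← sq_eq_sq₀ h1 (mul_nonneg hσ hb), mul_pow, hσ2, hb2]
  rcases h with h | h
  · linear_combination (-(1 - c * l) ^ 2) * h
  · linear_combination (-(c * l - 1) * (V * S - C ^ 2)) * h

end Algebra

/-! ### Closed forms for the constants -/

section Moments

variable {g : ℝ → ℝ} {F : Measure ℝ} {ε c : ℝ}

lemma sigmaStar_sq (hV : 0 ≤ varWeight g) (hC : 0 ≤ covWeight g F) (hε : 0 ≤ ε)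
    (hc : c = √(ε / (1 + varWeight g))) :
    sigmaStar g F ε ^ 2 = sd F ^ 2 + 2 * c * covWeight g F + c ^ 2 * varWeight g := by
  have h1 : c = √ε / √(1 + varWeight g) := by rw [hc, Real.sqrt_div hε]
  have h2 : c ^ 2 = ε / (1 + varWeight g) := by rw [hc, Real.sq_sqrt (by positivity)]
  rw [sigmaStar, Real.sq_sqrt (by positivity), h2, h1]
  ring

/-- `K` is thus the covariance of `F⁻¹` with the optimal quantile function `F⁻¹ + c γ`. -/
lemma kConst_eq (hV : 0 ≤ varWeight g) (hC : 0 ≤ covWeight g F) (hε : 0 ≤ ε)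
    (hc : c = √(ε / (1 + varWeight g))) :
    kConst F ε (muStar g F ε) (sigmaStar g F ε) = sd F ^ 2 + c * covWeight g F := by
  have h2 : c ^ 2 * (1 + varWeight g) = ε := by
    rw [hc, Real.sq_sqrt (by positivity), div_mul_cancel₀ _ (by positivity)]
  rw [kConst, sigmaStar_sq hV hC hε hc, muStar, ← hc]
  linear_combination (1 / 2) * h2

/-- The denominator under the root is `c²` times the numerator, so the root is `1 / c` and the terms
in `C` cancel. Nondegeneracy `hD` excludes the quotient `0 / 0`. -/
lemma lamFormula_eq (hV : 0 ≤ varWeight g) (hC : 0 ≤ covWeight g F) (hε : 0 < ε)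
    (hsd : 0 < sd F) (hc : c = √(ε / (1 + varWeight g)))
    (hD : varWeight g * sd F ^ 2 - covWeight g F ^ 2 ≠ 0) :
    lamFormula g F ε (muStar g F ε) (sigmaStar g F ε) = 1 / c := by
  have hc0 : 0 < c := by rw [hc]; positivity
  have e : (covWeight g F ^ 2 - varWeight g * sd F ^ 2) /
      ((sd F ^ 2 + c * covWeight g F) ^ 2 -
        (sd F ^ 2 + 2 * c * covWeight g F + c ^ 2 * varWeight g) * sd F ^ 2) = (1 / c) ^ 2 := by
    have e1 : (sd F ^ 2 + c * covWeight g F) ^ 2 -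
        (sd F ^ 2 + 2 * c * covWeight g F + c ^ 2 * varWeight g) * sd F ^ 2 =
        -(c ^ 2 * (varWeight g * sd F ^ 2 - covWeight g F ^ 2)) := by ring
    rw [e1, ← neg_sub (varWeight g * sd F ^ 2), neg_div_neg_eq, div_pow, one_pow, div_eq_div_iff
      (by positivity) (by positivity)]
    ring
  rw [lamFormula, kConst_eq hV hC hε.le hc, sigmaStar_sq hV hC hε.le hc, e,
    Real.sqrt_sq (by positivity)]
  field_simp
  ring

lemma corr_quantile_weight (hF : F ∈ M2) :
    corr (quantile F) (weight g) unif = covWeight g F / (sd F * √(varWeight g)) := by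
  have := hF.1
  have h : std (quantile F) unif = sd F := by
    rw [std, ← sd_sq_eq_variance_quantile, Real.sqrt_sq (show 0 ≤ sd F from Real.sqrt_nonneg _)]
  rw [corr, h]
  rfl

lemma mul_sub_sq_pos_of_corr_lt_one (hF : F ∈ M2) (hV : 0 < varWeight g)
    (hC : 0 ≤ covWeight g F) (hsd : 0 < sd F) (h : corr (quantile F) (weight g) unif < 1) :
    0 < varWeight g * sd F ^ 2 - covWeight g F ^ 2 := by
  rw [corr_quantile_weight hF, div_lt_one (by positivity)] at h
  have h2 := pow_lt_pow_left₀ h hC two_ne_zero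
  rw [mul_pow, Real.sq_sqrt hV.le] at h2
  linarith

lemma mul_sub_sq_eq_zero_of_corr_eq_one (hF : F ∈ M2) (hV : 0 < varWeight g)
    (hsd : 0 < sd F) (h : corr (quantile F) (weight g) unif = 1) :
    varWeight g * sd F ^ 2 - covWeight g F ^ 2 = 0 := by
  rw [corr_quantile_weight hF, div_eq_one_iff_eq (by positivity)] at h
  rw [h, mul_pow, Real.sq_sqrt hV.le]
  ring

end Moments

/-! ### The equation for `λ` and the optimal value -/

section Solution

variable {g : ℝ → ℝ} {F : Measure ℝ} {ε c l : ℝ}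

lemma covariance_quantile_hFun (hrepr : HasWeightRepresentation g) (hF : F ∈ M2) (μ σ l : ℝ) :
    cov[quantile F, hFun g F μ σ l; unif] =
      σ * (covWeight g F + l * sd F ^ 2) / std (tilted g F l) unif := by
  have := hF.1
  have hq := memLp_quantile hF
  rw [covariance_hFun _ hrepr hF, covariance_tilted hq hrepr hF, covariance_self hq.aemeasurable,
    ← sd_sq_eq_variance_quantile, covWeight]
  ring

lemma covariance_shifted_hFun (hrepr : HasWeightRepresentation g) (hF : F ∈ M2) (μ σ c l : ℝ) :
    cov[shifted g F c, hFun g F μ σ l; unif] =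
      σ * (covWeight g F + c * varWeight g + l * (sd F ^ 2 + c * covWeight g F)) /
        std (tilted g F l) unif := by
  have hs := memLp_shifted hrepr hF c
  have h1 : cov[shifted g F c, weight g; unif] = covWeight g F + c * varWeight g := by
    rw [covariance_comm, covWeight, covariance_comm (quantile F), varWeight,
      ← covariance_self hrepr.memLp.aemeasurable]
    exact covariance_add_const_mul_right hrepr.memLp (memLp_quantile hF) hrepr.memLp c
  rw [covariance_hFun _ hrepr hF, covariance_tilted hs hrepr hF, h1,
    covariance_comm (shifted g F c), covariance_quantile_shifted hrepr hF]
  ring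

lemma std_tilted_pos (hrepr : HasWeightRepresentation g) (hF : F ∈ M2) (hV : 0 < varWeight g)
    (hC : 0 ≤ covWeight g F) (hl : 0 ≤ l) : 0 < std (tilted g F l) unif := by
  refine lt_of_le_of_ne (Real.sqrt_nonneg _) fun h0 => ?_
  have h := std_tilted_sq hrepr hF l
  rw [← h0] at h
  have : 0 < varWeight g + 2 * l * covWeight g F + l ^ 2 * sd F ^ 2 := by positivity
  linarith

/-- With means and variances fixed, the distance depends only on the covariance with `F⁻¹`; distance
`√ε` amounts to that covariance being `σ_F² + c C`. -/
lemma wasserstein_hStar_eq_iff (hconc : ConcaveOn ℝ (Icc 0 1) g)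
    (hrepr : HasWeightRepresentation g) (hF : F ∈ M2) (hV : 0 < varWeight g)
    (hsd : 0 < sd F) (hε : 0 < ε) (hc : c = √(ε / (1 + varWeight g))) (hl : 0 ≤ l) :
    wasserstein F (lawOf (hStar g F ε l)) = ENNReal.ofReal (√ε) ↔
      varWeight g * sd F ^ 2 - covWeight g F ^ 2 = 0 ∨ c * l = 1 := by
  have := hF.1
  have hC := covWeight_nonneg hconc hrepr hF
  have hc0 : 0 < c := by rw [hc]; positivity
  have hcε : c ^ 2 * (1 + varWeight g) = ε := by
    rw [hc, Real.sq_sqrt (by positivity), div_mul_cancel₀ _ (by positivity)]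
  have hb := std_tilted_pos hrepr hF hV hC hl
  have hσ : 0 ≤ sigmaStar g F ε := Real.sqrt_nonneg _
  have hσ2 := sigmaStar_sq hV.le hC hε.le hc
  have hm : MemLp (hStar g F ε l) 2 unif := memLp_hFun hrepr hF
  rw [← mul_eq_mul_iff_of_sq_eq (by positivity : 0 < sd F ^ 2) hC hc0 hl hσ hb.le hσ2
      (std_tilted_sq hrepr hF l),
    wasserstein_lawOf_eq_iff hF hm (monotoneOn_hFun hconc hσ hl) hε.le,
    integral_sq_sub_eq_variance (memLp_quantile hF) hm]
  unfold hStar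
  rw [integral_hFun hrepr hF, variance_hFun hrepr hF hb.ne', covariance_quantile_hFun hrepr hF,
    ← sd_sq_eq_variance_quantile, ← mean_eq_integral_quantile, hσ2, muStar, ← hc,
    ← div_eq_iff hb.ne']
  constructor <;> intro h <;> linarith

/-- The two functions have equal means and equal variances, and their covariance equals that
variance, so their `L²` distance is zero. -/
lemma hStar_ae_eq_shifted (hg : IsDistortion g) (hconc : ConcaveOn ℝ (Icc 0 1) g)
    (hrepr : HasWeightRepresentation g) (hF : F ∈ M2) (hV : 0 < varWeight g)
    (hsd : 0 < sd F) (hε : 0 < ε) (hc : c = √(ε / (1 + varWeight g))) (hl : 0 ≤ l)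
    (h : varWeight g * sd F ^ 2 - covWeight g F ^ 2 = 0 ∨ c * l = 1) :
    shifted g F c =ᵐ[unif] hStar g F ε l := by
  have hC := covWeight_nonneg hconc hrepr hF
  have hc0 : 0 < c := by rw [hc]; positivity
  have hb := std_tilted_pos hrepr hF hV hC hl
  have hσ2 := sigmaStar_sq hV.le hC hε.le hc
  have hm : MemLp (hStar g F ε l) 2 unif := memLp_hFun hrepr hF
  have hσ : 0 ≤ sigmaStar g F ε := Real.sqrt_nonneg _
  have hs := memLp_shifted hrepr hF c
  refine ae_eq_of_integral_sq_sub_nonpos hs hm ?_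
  rw [integral_sq_sub_eq_variance hs hm]
  unfold hStar
  rw [integral_hFun hrepr hF, variance_hFun hrepr hF hb.ne', covariance_shifted_hFun hrepr hF,
    variance_shifted hrepr hF, integral_shifted hg hrepr hF, muStar, ← hc, ← hσ2,
    add_eq_mul_of_sq_eq (by positivity) hC hV hc0 hl hσ hb.le hσ2
      (std_tilted_sq hrepr hF l) h]
  have e (s b : ℝ) (hb : 0 < b) : s * (s * b) / b = s ^ 2 := by
    field_simp
  rw [e _ _ hb]
  refine le_of_eq ?_
  ring

lemma integral_weight_mul_hFun (hg : IsDistortion g) (hrepr : HasWeightRepresentation g)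
    (hF : F ∈ M2) (hV : 0 < varWeight g) (μ σ l : ℝ) :
    ∫ u, weight g u * hFun g F μ σ l u ∂unif =
      μ + σ * std (weight g) unif * corr (weight g) (tilted g F l) unif := by
  have hm : MemLp (hFun g F μ σ l) 2 unif := memLp_hFun hrepr hF
  have h := covariance_eq_sub hrepr.memLp hm
  rw [integral_hFun hrepr hF, integral_weight hg hrepr, covariance_hFun _ hrepr hF] at h
  have e : ∫ u, weight g u * hFun g F μ σ l u ∂unif =
      ∫ u, (weight g * hFun g F μ σ l) u ∂unif := rfl
  have hstd : std (weight g) unif ≠ 0 := (Real.sqrt_pos.2 hV).ne'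
  -- Only the standard deviation of `γ` has to cancel; that of the tilted function stays in the
  -- denominator on both sides.
  have e2 : σ * std (weight g) unif * corr (weight g) (tilted g F l) unif =
      σ / std (tilted g F l) unif * cov[weight g, tilted g F l; unif] := by
    rw [corr, div_mul_eq_div_div, mul_div_assoc']
    field_simp
  rw [e, e2]
  linarith

end Solution

end DistortionRisk

theorem theorem4 (g : ℝ → ℝ) (hg : IsDistortion g) (hconc : ConcaveOn ℝ (Icc 0 1) g)
    (hrepr : HasWeightRepresentation g)
    (hne : ∃ u ∈ Ioo (0 : ℝ) 1, weight g u ≠ 1)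
    (F : Measure ℝ) (hF : F ∈ M2) (hsd : 0 < sd F)
    (ε : ℝ) (hε : 0 < ε) :
    ∃ G : Measure ℝ,
      -- `G` is the unique worst-case distribution, with mean `μ*` and standard deviation `σ*`
      (IsWorstCase g F ε G ∧ ∀ G', IsWorstCase g F ε G' → G' = G) ∧
      mean G = muStar g F ε ∧ sd G = sigmaStar g F ε ∧
      -- the equation for `λ` has exactly one positive solution, given by the explicit formula
      (corr (quantile F) (weight g) unif < 1 →
        0 < lamFormula g F ε (muStar g F ε) (sigmaStar g F ε) ∧
        ∀ l : ℝ, 0 < l →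
          (wasserstein F (lawOf (hStar g F ε l)) = ENNReal.ofReal (√ε) ↔
            l = lamFormula g F ε (muStar g F ε) (sigmaStar g F ε))) ∧
      -- in the degenerate case of perfect correlation every `λ ≥ 0` solves the equation
      (corr (quantile F) (weight g) unif = 1 →
        ∀ l : ℝ, 0 ≤ l →
          wasserstein F (lawOf (hStar g F ε l)) = ENNReal.ofReal (√ε)) ∧
      -- for a solution `λ`, `G` has quantile function `h_λ`, and the value is explicit
      (∀ l : ℝ, 0 ≤ l →
        wasserstein F (lawOf (hStar g F ε l)) = ENNReal.ofReal (√ε) →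
          (∀ᵐ u ∂unif, quantile G u = hStar g F ε l u) ∧
          (∀ u ∈ Ioo (0 : ℝ) 1, ContinuousAt (weight g) u →
            quantile G u = hStar g F ε l u) ∧
          riskMeasure g G =
            ((muStar g F ε + sigmaStar g F ε * std (weight g) unif *
              corr (weight g) (tilted g F l) unif : ℝ) : EReal)) := by
  have := hF.1
  have hV := varWeight_pos hg hconc hrepr hne
  have hC := covWeight_nonneg hconc hrepr hF
  obtain ⟨c, hc⟩ : ∃ c, c = √(ε / (1 + varWeight g)) := ⟨_, rfl⟩
  have hc0 : 0 < c := by rw [hc]; positivity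
  have hcε : c ^ 2 * (1 + varWeight g) = ε := by
    rw [hc, Real.sq_sqrt (by positivity), div_mul_cancel₀ _ (by positivity)]
  have hs := memLp_shifted hrepr hF c
  have hσ : 0 ≤ sigmaStar g F ε := Real.sqrt_nonneg _
  refine ⟨lawOf (shifted g F c),
    isWorstCase_lawOf_shifted hg hconc hrepr hF hc0 hcε hε.le, ?_, ?_, ?_, ?_, ?_⟩
  · rw [mean_lawOf hs, integral_shifted hg hrepr hF, muStar, hc]
  · rw [sd_lawOf hs, variance_shifted hrepr hF, ← sigmaStar_sq hV.le hC hε.le hc,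
      Real.sqrt_sq hσ]
  · intro hcorr
    have hD := (mul_sub_sq_pos_of_corr_lt_one hF hV hC hsd hcorr).ne'
    rw [lamFormula_eq hV.le hC hε hsd hc hD]
    refine ⟨by positivity, fun l hl => ?_⟩
    rw [wasserstein_hStar_eq_iff hconc hrepr hF hV hsd hε hc hl.le, or_iff_right hD,
      eq_div_iff hc0.ne', mul_comm]
  · intro hcorr l hl
    exact (wasserstein_hStar_eq_iff hconc hrepr hF hV hsd hε hc hl).2
      (Or.inl (mul_sub_sq_eq_zero_of_corr_eq_one hF hV hsd hcorr))
  · intro l hl hsol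
    have hae := hStar_ae_eq_shifted hg hconc hrepr hF hV hsd hε hc hl
      ((wasserstein_hStar_eq_iff hconc hrepr hF hV hsd hε hc hl).1 hsol)
    have hlaw : lawOf (shifted g F c) = lawOf (hStar g F ε l) := Measure.map_congr hae
    have hm : MemLp (hStar g F ε l) 2 unif := memLp_hFun hrepr hF
    have hmono : MonotoneOn (hStar g F ε l) (Ioo 0 1) := monotoneOn_hFun hconc hσ hl
    -- The a.e. identity determines the law, so `G` may be presented through `h_λ`. Its quantile
    -- function then agrees with `h_λ` at each point of left continuity, not merely almost
    -- everywhere.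
    rw [hlaw]
    refine ⟨ae_quantile_lawOf hmono, fun u hu hcont => ?_, ?_⟩
    · exact quantile_lawOf hmono hu (continuousWithinAt_hFun hu hcont)
    · rw [hrepr.repr _ (lawOf_mem_M2 hm), integral_weight_mul_quantile_lawOf hmono, hStar,
        integral_weight_mul_hFun hg hrepr hF hV]
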